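/- Let $N$ oscillators have natural frequencies $\omega_1,\dots,\omega_N\in\mathbb R$ and symmetric coupling gains $K_{ij}=K_{ji}\ge 0$ ($i\ne j$) such that the graph with an edge $\{i,j\}$ whenever $K_{ij}>0$ is connected, and consider the Kuramoto network $$\dot\theta_i=\omega_i+\sum_{j\ne i}\frac{K_{ij}}{N}\sin(\theta_j-\theta_i),\qquad i=1,\dots,N .$$ Let $e=\binom N2$, let $B\in\mathbb R^{N\times e}$ be the oriented incidence matrix of the complete graph (the column of the pair $i<j$ has $1$ in row $i$, $-1$ in row $j$ and $0$ elsewhere), let $\tilde K=(\tilde K_1,\dots,\tilde K_e)$ be the vector of the gains $K_{ij}$, $i<j$, and put $K=\frac1N\mathrm{diag}(\tilde K)$, $X=B^\top\theta$, $V=B^\top\dot\theta$, and $\Delta_m=\max_i\tilde K_i-\min_i\tilde K_i$ (over all $e$ entries, zero or not). Let $\delta>0$, and suppose that $\tilde K_i\ge\frac{N-2}{2}\Delta_m$ for every $i$ with $\tilde K_i\neq0$ and that $$\frac1N\sum_{i:\tilde K_i>0}\bigl(2\tilde K_i-(N-2)\Delta_m\bigr)\sin|\delta|>\sum_{i=1}^e|(B^\top\omega)_i|+\frac1N\sum_{i:\tilde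 K_i=0}(N-2)\Delta_m .$$ Let $\mathcal J$ be the set of all vectors $V=B^\top\omega-B^\top BK\sin(X)$ with $X\in(-\frac\pi2,\frac\pi2)^e\cap\mathrm{Col}(B^\top)$ such that, for $i=1,\dots,e$, $|(B^\top\omega)_i|\le\frac2N\tilde K_i+\frac1N\sum_{j\ne i}|(B^\top B)_{ij}|\,\tilde K_j\sin|x_j|$. Let $$\mathcal P=\Bigl\{X\in(-\pi+\delta,\pi-\delta]^e\cap\mathrm{Col}(B^\top):\ \sum_{i=1}^e|x_i|-(N-1)\pi\le0\Bigr\},\qquad \mathcal N=\{(X,V): X\in\mathcal P,\ V\in\mathcal J\}.$$ Then for every solution $\theta:[0,\infty)\to\mathbb R^N$ of the network (the phases being lifted to $\mathbb R$) with $(X(0),V(0))\in\mathcal N$, all angular frequencies converge to the mean of the natural frequencies: $$\lim_{t\to\infty}\dot\theta_i(t)=\frac1N\sum_{k=1}^N\omega_k,\qquad i=1,\dots,N .$$ The same conclusion holds for every solution with $X(0)\in\mathcal P$, without the requirement $V(0)\in\mathcal J$. -/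

import Mathlib

open Filter Topology Set Matrix

namespace Kuramoto

/-- The pairs `i < j` of oscillators: the `N.choose 2` edges of the all-to-all graph. -/
abbrev Edge (N : ℕ) : Type := {p : Fin N × Fin N // p.1 < p.2}

/-- The oriented incidence matrix `B` of the all-to-all graph: the column of the edge `(i, j)`
has the entry `1` in row `i` and `-1` in row `j`. -/
def incidence (N : ℕ) : Matrix (Fin N) (Edge N) ℝ :=
  fun v p => if v = p.1.1 then 1 else if v = p.1.2 then -1 else 0

/-- The right-hand side of the Kuramoto equations
`θ_i' = ω_i + ∑_{j ≠ i} (K_ij / N) sin (θ_j - θ_i)`. -/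
noncomputable def field {N : ℕ} (ω : Fin N → ℝ) (K : Matrix (Fin N) (Fin N) ℝ)
    (θ : Fin N → ℝ) : Fin N → ℝ :=
  fun i => ω i + ∑ j ∈ Finset.univ.erase i, K i j / N * Real.sin (θ j - θ i)

/-- `θ` is (a real lift of) a solution, on `[0, ∞)`, of the Kuramoto equations. -/
def IsSolution {N : ℕ} (ω : Fin N → ℝ) (K : Matrix (Fin N) (Fin N) ℝ)
    (θ : ℝ → Fin N → ℝ) : Prop :=
  ∀ t : ℝ, 0 ≤ t → HasDerivWithinAt θ (field ω K (θ t)) (Ici 0) t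

/-- The interconnection graph: `i` and `j` are joined when their coupling gain is positive. -/
def couplingGraph {N : ℕ} (K : Matrix (Fin N) (Fin N) ℝ) : SimpleGraph (Fin N) :=
  SimpleGraph.fromRel fun i j => 0 < K i j

/-- The vector of the coupling gains of all edges, `K̃ = (K_12, K_13, …, K_{(N-1)N})`. -/
def gain {N : ℕ} (K : Matrix (Fin N) (Fin N) ℝ) : Edge N → ℝ :=
  fun p => K p.1.1 p.1.2

/-- The diagonal coupling strength matrix `(1 / N) diag K̃`. -/
noncomputable def strength {N : ℕ} (K : Matrix (Fin N) (Fin N) ℝ) :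
    Matrix (Edge N) (Edge N) ℝ :=
  (1 / (N : ℝ)) • Matrix.diagonal (gain K)

/-- `Δ_m = K̃_max - K̃_min`, the maximum and minimum being over all entries of `K̃`. -/
noncomputable def gainSpread {N : ℕ} (K : Matrix (Fin N) (Fin N) ℝ) : ℝ :=
  (⨆ p, gain K p) - ⨅ p, gain K p

/-- `Col(Bᵀ)`, the column space of the transposed incidence matrix. -/
def colSpace (N : ℕ) : Submodule ℝ (Edge N → ℝ) :=
  LinearMap.range (incidence N)ᵀ.mulVecLin

/-- The set `𝒥` of the vectors `V = Bᵀ ω - Bᵀ B K sin X`, where `X` ranges over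
`(-π/2, π/2)^e ∩ Col(Bᵀ)` and satisfies the bound on the natural frequency differences. -/
def velocitySet {N : ℕ} (ω : Fin N → ℝ) (K : Matrix (Fin N) (Fin N) ℝ) :
    Set (Edge N → ℝ) :=
  {V | ∃ X : Edge N → ℝ,
    (∀ p, X p ∈ Ioo (-(Real.pi / 2)) (Real.pi / 2)) ∧ X ∈ colSpace N ∧
    V = (incidence N)ᵀ *ᵥ ω
      - ((incidence N)ᵀ * incidence N * strength K) *ᵥ (fun p => Real.sin (X p)) ∧
    ∀ p, |((incidence N)ᵀ *ᵥ ω) p| ≤ 2 / (N : ℝ) * gain K p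
      + 1 / (N : ℝ) * ∑ q ∈ Finset.univ.erase p,
          |((incidence N)ᵀ * incidence N) p q| * gain K q * Real.sin |X q|}

/-- The phase differences allowed in `𝒩`: the `X ∈ (-π + δ, π - δ]^e ∩ Col(Bᵀ)` with
`∑ |x_i| - (N - 1) π ≤ 0`. -/
def phaseSet (N : ℕ) (δ : ℝ) : Set (Edge N → ℝ) :=
  {X | (∀ p, X p ∈ Ioc (-Real.pi + δ) (Real.pi - δ)) ∧ X ∈ colSpace N ∧
    ∑ p, |X p| - ((N : ℝ) - 1) * Real.pi ≤ 0}

/-- The set `𝒩` of initial conditions `(X, V)`. -/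
def initialSet {N : ℕ} (ω : Fin N → ℝ) (K : Matrix (Fin N) (Fin N) ℝ) (δ : ℝ) :
    Set ((Edge N → ℝ) × (Edge N → ℝ)) :=
  {Z | Z.1 ∈ phaseSet N δ ∧ Z.2 ∈ velocitySet ω K}

/-- The condition on the coupling gains under which `𝒩` is considered. -/
def GainCondition {N : ℕ} (ω : Fin N → ℝ) (K : Matrix (Fin N) (Fin N) ℝ) (δ : ℝ) : Prop :=
  (∀ p, gain K p ≠ 0 → ((N : ℝ) - 2) / 2 * gainSpread K ≤ gain K p) ∧
  1 / (N : ℝ) * (∑ p with 0 < gain K p, (2 * gain K p - ((N : ℝ) - 2) * gainSpread K))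
      * Real.sin |δ|
    > ∑ p, |((incidence N)ᵀ *ᵥ ω) p|
      + 1 / (N : ℝ) * ∑ p with gain K p = 0, ((N : ℝ) - 2) * gainSpread K

/-- All angular frequencies `θ_i'(t)` converge to `Ω` as `t → ∞`. -/
def FrequenciesTendTo {N : ℕ} (θ : ℝ → Fin N → ℝ) (Ω : ℝ) : Prop :=
  ∀ i, Tendsto (fun t => deriv (fun s => θ s i) t) atTop (𝓝 Ω)

end Kuramoto

/-! Invariance. Put D = π - δ; the phases start within an arc of length D. Suppose a and b are the
extreme phases, with θ_a - θ_b = D. Every other oscillator k lies between them, and subadditivity of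
sine on [0, π] shows that k pulls them together with strength at least min(K_ak, K_bk) sin D / N.
With the direct coupling, the gap changes at rate at most ω_a - ω_b - `pairGain` · sin D / N
(`field_sub_field_le`). Since sin D = sin δ, the gain condition makes this negative
(`sub_lt_pairGain_mul_sin`), so the arc never widens beyond D. That step compares sums over all
edges with a single pair: `card_sub_one_mul_abs_le_sum_edge` for the frequencies,
`sum_gain_le_pairGain` for the gains.

Convergence. By symmetry of K, the network in the frame rotating with the mean frequency Ω is the
gradient flow of `potential`, which decreases at rate ∑ (θ_i' - Ω)². Bounded phase differences bound
the potential below, and the rate is Lipschitz in time, so a Barbalat argument sends it to zero. -/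

namespace Kuramoto

variable {N : ℕ}

/-! ### Sums over the edges of the complete graph -/

section Edges

lemma sum_sum_eq_two_mul_sum_edge (f : Fin N → Fin N → ℝ) (hs : ∀ i j, f i j = f j i)
    (hd : ∀ i, f i i = 0) :
    ∑ i, ∑ j, f i j = 2 * ∑ p : Edge N, f p.1.1 p.1.2 := by
  have h1 : ∑ p : Edge N, f p.1.1 p.1.2 = ∑ i, ∑ j, if i < j then f i j else 0 := by
    rw [← Fintype.sum_prod_type', ← Finset.sum_filter]
    exact (Finset.sum_subtype _ (by simp) (fun q : Fin N × Fin N => f q.1 q.2)).symm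
  have h2 : ∑ i, ∑ j, (if i < j then f i j else 0) = ∑ i, ∑ j, if j < i then f i j else 0 := by
    rw [Finset.sum_comm]
    refine Finset.sum_congr rfl fun i _ => Finset.sum_congr rfl fun j _ => ?_
    rw [hs]
  have h3 : ∑ i, ∑ j, f i j = ∑ i, ∑ j, (if i < j then f i j else 0)
      + ∑ i, ∑ j, if j < i then f i j else 0 := by
    rw [← Finset.sum_add_distrib]
    refine Finset.sum_congr rfl fun i _ => ?_
    rw [← Finset.sum_add_distrib]
    refine Finset.sum_congr rfl fun j _ => ?_
    rcases lt_trichotomy i j with h | h | h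
    · simp [h, h.le]
    · subst h; simp [hd]
    · simp [h, h.le]
  rw [h3, ← h2, h1]; ring

lemma two_mul_card_edge : 2 * (Fintype.card (Edge N) : ℝ) = N * ((N : ℝ) - 1) := by
  have h := sum_sum_eq_two_mul_sum_edge (N := N) (fun i j => if i = j then 0 else 1)
    (fun i j => by simp [eq_comm]) (by simp)
  have h2 : ∀ i : Fin N, ∑ j, (if i = j then (0 : ℝ) else 1) = (N : ℝ) - 1 := by
    intro i
    have : ∀ j, (if i = j then (0 : ℝ) else 1) = 1 - if i = j then 1 else 0 := by
      intro j; split_ifs <;> simp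
    simp [this]
  have h3 : ∀ p : Edge N, (if p.1.1 = p.1.2 then (0 : ℝ) else 1) = 1 := fun p => by
    simp [p.2.ne]
  simp only [h2, h3, Finset.sum_const, Finset.card_univ, Fintype.card_fin, nsmul_eq_mul,
    mul_one] at h
  exact h.symm

lemma incidence_transpose_mulVec (x : Fin N → ℝ) (p : Edge N) :
    ((incidence N)ᵀ *ᵥ x) p = x p.1.1 - x p.1.2 := by
  have h : ∀ v, incidence N v p * x v
      = (if v = p.1.1 then x v else 0) - if v = p.1.2 then x v else 0 := by
    intro v
    have := p.2.ne
    unfold incidence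
    split_ifs <;> simp_all
  simp [Matrix.mulVec, dotProduct, h]

lemma card_erase_erase {a b : Fin N} (hab : a ≠ b) :
    (((Finset.univ.erase a).erase b).card : ℝ) = (N : ℝ) - 2 := by
  have h1 := Finset.card_erase_add_one (show b ∈ Finset.univ.erase a by simp [hab.symm])
  have h2 := Finset.card_erase_add_one (Finset.mem_univ a)
  simp only [Finset.card_univ, Fintype.card_fin] at h2
  have : (((Finset.univ.erase a).erase b).card : ℝ) + 2 = N := by
    exact_mod_cast (show ((Finset.univ.erase a).erase b).card + 2 = N by omega)
  linarith

/-- In the double sum of |x_i - x_j|, rows a and b together contribute at least N |x_a - x_b|, and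
each of the other N - 2 rows at least |x_a - x_b|, by the triangle inequality. Each edge is counted
twice. -/
lemma card_sub_one_mul_abs_le_sum_edge (x : Fin N → ℝ) {a b : Fin N} (hab : a ≠ b) :
    ((N : ℝ) - 1) * |x a - x b| ≤ ∑ p, |((incidence N)ᵀ *ᵥ x) p| := by
  simp only [incidence_transpose_mulVec]
  have h := sum_sum_eq_two_mul_sum_edge (fun i j => |x i - x j|)
    (fun i j => abs_sub_comm _ _) (by simp)
  have tri : ∀ k, |x a - x b| ≤ |x a - x k| + |x b - x k| := fun k => by
    rw [abs_sub_comm (x b)]; exact abs_sub_le _ _ _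
  have hrow : ∀ k, |x a - x b| ≤ ∑ j, |x k - x j| := fun k => by
    calc |x a - x b| ≤ |x k - x a| + |x k - x b| := by
          rw [abs_sub_comm (x k), abs_sub_comm (x k)]; exact tri k
      _ = ∑ j ∈ {a, b}, |x k - x j| := by rw [Finset.sum_pair hab]
      _ ≤ _ := Finset.sum_le_sum_of_subset_of_nonneg (Finset.subset_univ _)
          (fun _ _ _ => abs_nonneg _)
  have hab2 : (N : ℝ) * |x a - x b| ≤ ∑ j, |x a - x j| + ∑ j, |x b - x j| := by
    rw [← Finset.sum_add_distrib]
    simpa using Finset.card_nsmul_le_sum Finset.univ _ _ (fun k _ => tri k)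
  have hmem : b ∈ Finset.univ.erase a := by simp [hab.symm]
  have hrest := Finset.card_nsmul_le_sum ((Finset.univ.erase a).erase b) _ _
    (fun k _ => hrow k)
  rw [nsmul_eq_mul, card_erase_erase hab] at hrest
  rw [← Finset.add_sum_erase _ _ (Finset.mem_univ a), ← Finset.add_sum_erase _ _ hmem] at h
  nlinarith

end Edges

/-! ### From the gain condition to a bound for one pair -/

section Gains

/-- The effective gain pulling `a` and `b` together when they are the two extreme phases. -/
noncomputable def pairGain (K : Matrix (Fin N) (Fin N) ℝ) (a b : Fin N) : ℝ :=
  2 * K a b + ∑ k ∈ (Finset.univ.erase a).erase b, min (K a k) (K b k)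

lemma exists_gain_eq {K : Matrix (Fin N) (Fin N) ℝ} (hK : K.IsSymm) {i j : Fin N}
    (hij : i ≠ j) : ∃ p, gain K p = K i j := by
  rcases lt_or_gt_of_ne hij with h | h
  · exact ⟨⟨(i, j), h⟩, rfl⟩
  · exact ⟨⟨(j, i), h⟩, hK.apply i j⟩

lemma gain_le_iInf_add_gainSpread (K : Matrix (Fin N) (Fin N) ℝ) (p : Edge N) :
    gain K p ≤ (⨅ q, gain K q) + gainSpread K := by
  have := le_ciSup (Set.finite_range (gain K)).bddAbove p
  unfold gainSpread; linarith

lemma iInf_le_gain (K : Matrix (Fin N) (Fin N) ℝ) (p : Edge N) : (⨅ q, gain K q) ≤ gain K p :=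
  ciInf_le (Set.finite_range (gain K)).bddBelow p

lemma gainSpread_nonneg (K : Matrix (Fin N) (Fin N) ℝ) : 0 ≤ gainSpread K := by
  rcases isEmpty_or_nonempty (Edge N) with h | ⟨⟨p⟩⟩
  · simp [gainSpread, Real.iSup_of_isEmpty, Real.iInf_of_isEmpty]
  · have := gain_le_iInf_add_gainSpread K p
    have := iInf_le_gain K p
    linarith

lemma sum_gain_le_pairGain {K : Matrix (Fin N) (Fin N) ℝ} (hK : K.IsSymm) {a b : Fin N}
    (hab : a ≠ b) :
    ∑ p, (2 * gain K p - ((N : ℝ) - 2) * gainSpread K) ≤ ((N : ℝ) - 1) * pairGain K a b := by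
  set m := ⨅ q, gain K q with hm
  set D := gainSpread K with hD
  have hD0 : 0 ≤ D := gainSpread_nonneg K
  have lo : ∀ i j, i ≠ j → m ≤ K i j := fun i j h => by
    obtain ⟨p, hp⟩ := exists_gain_eq hK h
    exact hp ▸ iInf_le_gain K p
  have hi : ∀ i j, i ≠ j → K i j ≤ m + D := fun i j h => by
    obtain ⟨p, hp⟩ := exists_gain_eq hK h
    exact hp ▸ gain_le_iInf_add_gainSpread K p
  have hcard := two_mul_card_edge (N := N)
  rw [Finset.sum_sub_distrib, ← Finset.mul_sum]
  simp only [Finset.sum_const, Finset.card_univ, nsmul_eq_mul]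
  -- With e edges, `pairGain` is at least N m and the left side at most e (2m - (N - 4) D), where 2e
  -- = N (N - 1). The crude bounds therefore suffice exactly when (N - 4) D may be dropped; smaller
  -- N are treated directly.
  by_cases hN : 4 ≤ N
  · have hN' : (4 : ℝ) ≤ N := by exact_mod_cast hN
    have h1 : (N : ℝ) * m ≤ pairGain K a b := by
      have := Finset.card_nsmul_le_sum ((Finset.univ.erase a).erase b)
        (fun k => min (K a k) (K b k)) m (fun k hk => by
          simp only [Finset.mem_erase, Finset.mem_univ, and_true] at hk
          exact le_min (lo _ _ (Ne.symm hk.2)) (lo _ _ (Ne.symm hk.1)))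
      rw [nsmul_eq_mul, card_erase_erase hab] at this
      have := lo a b hab
      unfold pairGain
      linarith
    have h2 : ∑ p, gain K p ≤ Fintype.card (Edge N) * (m + D) := by
      have := Finset.sum_le_card_nsmul Finset.univ (gain K) (m + D)
        (fun p _ => gain_le_iInf_add_gainSpread K p)
      rwa [nsmul_eq_mul, Finset.card_univ] at this
    have h3 : (0 : ℝ) ≤ Fintype.card (Edge N) * ((N - 4) * D) := by
      have : (0 : ℝ) ≤ N - 4 := by linarith
      positivity
    have h4 := mul_le_mul_of_nonneg_left h1 (show (0 : ℝ) ≤ (N : ℝ) - 1 by linarith)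
    have h5 := congrArg (· * m) hcard
    linarith
  · have hsum := sum_sum_eq_two_mul_sum_edge (fun i j => if i = j then 0 else K i j)
      (fun i j => by simp only [hK.apply, eq_comm]) (by simp)
    have hg : ∀ p : Edge N, (if p.1.1 = p.1.2 then 0 else K p.1.1 p.1.2) = gain K p := fun p => by
      simp [p.2.ne, gain]
    simp only [hg] at hsum
    rw [← hsum]
    clear_value m D
    have hsy := hK.apply
    interval_cases N
    · exact a.elim0
    · exact absurd (Subsingleton.elim a b) hab
    · have e0 : ((Finset.univ : Finset (Fin 2)).erase 0).erase 1 = ∅ := by decide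
      have e1 : ((Finset.univ : Finset (Fin 2)).erase 1).erase 0 = ∅ := by decide
      have := hsy 0 1
      fin_cases a <;> fin_cases b <;> simp_all [pairGain, Fin.sum_univ_two] <;> linarith
    · have e01 : ((Finset.univ : Finset (Fin 3)).erase 0).erase 1 = {2} := by decide
      have e10 : ((Finset.univ : Finset (Fin 3)).erase 1).erase 0 = {2} := by decide
      have e02 : ((Finset.univ : Finset (Fin 3)).erase 0).erase 2 = {1} := by decide
      have e20 : ((Finset.univ : Finset (Fin 3)).erase 2).erase 0 = {1} := by decide
      have e12 : ((Finset.univ : Finset (Fin 3)).erase 1).erase 2 = {0} := by decide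
      have e21 : ((Finset.univ : Finset (Fin 3)).erase 2).erase 1 = {0} := by decide
      have s01 := hsy 0 1
      have s02 := hsy 0 2
      have s12 := hsy 1 2
      have l01 := lo 0 1 (by decide)
      have l02 := lo 0 2 (by decide)
      have l12 := lo 1 2 (by decide)
      have h01 := hi 0 1 (by decide)
      have h02 := hi 0 2 (by decide)
      have h12 := hi 1 2 (by decide)
      have hc : (Fintype.card (Edge 3) : ℝ) = 3 := by
        push_cast at hcard; linarith
      rw [hc]
      have hS : ∑ i, ∑ j, (if i = j then 0 else K i j) = 2 * (K 0 1 + K 0 2 + K 1 2) := by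
        simp only [Fin.sum_univ_three, if_true, s01, s02, s12]
        simp
        ring
      rw [hS]
      have key : ∀ x y z : ℝ, m ≤ x → m ≤ y → m ≤ z → x ≤ m + D → y ≤ m + D → z ≤ m + D →
          2 * (x + y + z) - 3 * D ≤ 2 * (2 * x + min y z) := by
        intro x y z hx hy hz hx' hy' hz'
        rcases le_total y z with h | h
        · rw [min_eq_left h]; linarith
        · rw [min_eq_right h]; linarith
      have k1 := key _ _ _ l01 l02 l12 h01 h02 h12
      have k2 := key _ _ _ l02 l01 l12 h02 h01 h12
      have k3 := key _ _ _ l12 l01 l02 h12 h01 h02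
      have k4 := key _ _ _ l01 l12 l02 h01 h12 h02
      have k5 := key _ _ _ l02 l12 l01 h02 h12 h01
      have k6 := key _ _ _ l12 l02 l01 h12 h02 h01
      obtain rfl | rfl | rfl : a = 0 ∨ a = 1 ∨ a = 2 := by clear hab; fin_cases a <;> simp
      all_goals obtain rfl | rfl | rfl : b = 0 ∨ b = 1 ∨ b = 2 := by
                  clear hab; fin_cases b <;> simp
      all_goals first
        | exact absurd rfl hab
        | simp only [pairGain, e01, e10, e02, e20, e12, e21, Finset.sum_singleton, s01, s02, s12]
          push_cast
          linarith

lemma sub_lt_pairGain_mul_sin {ω : Fin N → ℝ} {K : Matrix (Fin N) (Fin N) ℝ} {δ : ℝ}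
    (hK : K.IsSymm) (hnonneg : ∀ i j, i < j → 0 ≤ K i j) (hgain : GainCondition ω K δ)
    (hδ : 0 < δ) (hδπ : δ < Real.pi) {a b : Fin N} (hab : a ≠ b) :
    ω a - ω b < 1 / (N : ℝ) * (pairGain K a b * Real.sin δ) := by
  have hs : 0 < Real.sin δ := Real.sin_pos_of_pos_of_lt_pi hδ hδπ
  have hN : (2 : ℝ) ≤ N := by
    have : 2 ≤ N := by
      have := a.2
      have := b.2
      have : (a : ℕ) ≠ b := fun h => hab (Fin.ext h)
      omega
    exact_mod_cast this
  have hg := hgain.2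
  rw [abs_of_pos hδ] at hg
  have hfilter : Finset.univ.filter (fun p => ¬ 0 < gain K p)
      = Finset.univ.filter (fun p => gain K p = 0) := by
    refine Finset.filter_congr fun p _ => ?_
    have := hnonneg _ _ p.2
    change 0 ≤ gain K p at this
    exact ⟨fun h => le_antisymm (not_lt.1 h) this, fun h => h ▸ lt_irrefl _⟩
  have hsplit := Finset.sum_filter_add_sum_filter_not Finset.univ (fun p => 0 < gain K p)
    (fun p => 2 * gain K p - ((N : ℝ) - 2) * gainSpread K)
  rw [hfilter] at hsplit
  have hzero : ∑ p with gain K p = 0, (2 * gain K p - ((N : ℝ) - 2) * gainSpread K)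
      = - ∑ p with gain K p = 0, ((N : ℝ) - 2) * gainSpread K := by
    rw [← Finset.sum_neg_distrib]
    refine Finset.sum_congr rfl fun p hp => ?_
    rw [(Finset.mem_filter.1 hp).2]; ring
  have hZ : 0 ≤ ∑ p with gain K p = 0, ((N : ℝ) - 2) * gainSpread K :=
    Finset.sum_nonneg fun p _ => mul_nonneg (by linarith) (gainSpread_nonneg K)
  rw [hzero] at hsplit
  have h1 := sum_gain_le_pairGain hK hab
  have h2 := card_sub_one_mul_abs_le_sum_edge ω hab
  set Z := ∑ p with gain K p = 0, ((N : ℝ) - 2) * gainSpread K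
  set P := ∑ p with 0 < gain K p, (2 * gain K p - ((N : ℝ) - 2) * gainSpread K)
  rw [← hsplit] at h1
  have hNinv : 0 < 1 / (N : ℝ) := by positivity
  have h3 : (P - Z) * Real.sin δ ≤ ((N : ℝ) - 1) * pairGain K a b * Real.sin δ :=
    mul_le_mul_of_nonneg_right (by linarith) hs.le
  -- The full edge sum is P - Z, while the gain condition controls P sin δ - Z, which is at most (P
  -- - Z) sin δ.
  have h4 : Z * Real.sin δ ≤ Z := mul_le_of_le_one_right hZ (Real.sin_le_one _)
  have h5 : 1 / (N : ℝ) * (P * Real.sin δ - Z)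
      ≤ 1 / (N : ℝ) * (((N : ℝ) - 1) * pairGain K a b * Real.sin δ) :=
    mul_le_mul_of_nonneg_left (by linarith) hNinv.le
  have h6 : ((N : ℝ) - 1) * |ω a - ω b|
      < ((N : ℝ) - 1) * (1 / (N : ℝ) * (pairGain K a b * Real.sin δ)) := by
    linarith
  exact (le_abs_self _).trans_lt (lt_of_mul_lt_mul_left h6 (by linarith))

end Gains

/-! ### Invariance of the arc of length π - δ -/

section Invariance

lemma sin_add_le_sin_add_sin {u v : ℝ} (hu : 0 ≤ u) (hv : 0 ≤ v) (huv : u + v ≤ Real.pi) :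
    Real.sin (u + v) ≤ Real.sin u + Real.sin v := by
  have h1 := Real.sin_nonneg_of_nonneg_of_le_pi hu (by linarith)
  have h2 := Real.sin_nonneg_of_nonneg_of_le_pi hv (by linarith)
  rw [Real.sin_add]
  nlinarith [Real.cos_le_one u, Real.cos_le_one v]

lemma min_mul_sin_le {u v k l : ℝ} (hu : 0 ≤ u) (hv : 0 ≤ v) (huv : u + v ≤ Real.pi)
    (hk : 0 ≤ k) (hl : 0 ≤ l) :
    min k l * Real.sin (u + v) ≤ k * Real.sin u + l * Real.sin v := by
  have h1 := Real.sin_nonneg_of_nonneg_of_le_pi hu (by linarith)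
  have h2 := Real.sin_nonneg_of_nonneg_of_le_pi hv (by linarith)
  have h3 := mul_le_mul_of_nonneg_left (sin_add_le_sin_add_sin hu hv huv) (le_min hk hl)
  have h4 := mul_le_mul_of_nonneg_right (min_le_left k l) h1
  have h5 := mul_le_mul_of_nonneg_right (min_le_right k l) h2
  linarith

lemma field_sub_field_le {ω : Fin N → ℝ} {K : Matrix (Fin N) (Fin N) ℝ} (hK : K.IsSymm)
    (hK0 : ∀ i j, i ≠ j → 0 ≤ K i j) {θ : Fin N → ℝ} {D : ℝ} (hD : D ≤ Real.pi)
    (hθ : ∀ i j, θ i - θ j ≤ D) {a b : Fin N} (hab : a ≠ b) (hmax : θ a - θ b = D) :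
    field ω K θ a - field ω K θ b
      ≤ ω a - ω b - 1 / (N : ℝ) * (pairGain K a b * Real.sin D) := by
  have hsum : pairGain K a b * Real.sin D ≤ 2 * K a b * Real.sin D
      + ∑ k ∈ (Finset.univ.erase a).erase b,
        (K a k * Real.sin (θ a - θ k) + K b k * Real.sin (θ k - θ b)) := by
    unfold pairGain
    rw [add_mul, Finset.sum_mul]
    gcongr with k hk
    simp only [Finset.mem_erase, Finset.mem_univ, and_true] at hk
    have e : D = (θ a - θ k) + (θ k - θ b) := by linarith
    have := min_mul_sin_le (u := θ a - θ k) (v := θ k - θ b) (by linarith [hθ k b])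
      (by linarith [hθ a k]) (by linarith) (hK0 a k (Ne.symm hk.2)) (hK0 b k (Ne.symm hk.1))
    rwa [← e] at this
  have hb : b ∈ Finset.univ.erase a := by simp [hab.symm]
  have ha : a ∈ Finset.univ.erase b := by simp [hab]
  have hNn : 0 ≤ 1 / (N : ℝ) := by positivity
  have hfield : field ω K θ a - field ω K θ b = ω a - ω b - 1 / (N : ℝ) *
      (2 * K a b * Real.sin D + ∑ k ∈ (Finset.univ.erase a).erase b,
        (K a k * Real.sin (θ a - θ k) + K b k * Real.sin (θ k - θ b))) := by
    unfold field
    rw [← Finset.add_sum_erase _ _ hb, ← Finset.add_sum_erase _ _ ha,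
      Finset.erase_right_comm (a := b), ← neg_sub (θ a) (θ b), hmax, hK.apply a b, mul_add,
      Finset.mul_sum, Real.sin_neg]
    have : ∑ k ∈ (Finset.univ.erase a).erase b, 1 / (N : ℝ) *
        (K a k * Real.sin (θ a - θ k) + K b k * Real.sin (θ k - θ b))
        = - ∑ k ∈ (Finset.univ.erase a).erase b, K a k / N * Real.sin (θ k - θ a)
          + ∑ k ∈ (Finset.univ.erase a).erase b, K b k / N * Real.sin (θ k - θ b) := by
      rw [← Finset.sum_neg_distrib, ← Finset.sum_add_distrib]
      refine Finset.sum_congr rfl fun k _ => ?_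
      rw [← neg_sub (θ k) (θ a), Real.sin_neg]; ring
    rw [this]; ring
  rw [hfield]
  have := mul_le_mul_of_nonneg_left hsum hNn
  linarith

lemma IsSolution.hasDerivWithinAt_apply {ω : Fin N → ℝ} {K : Matrix (Fin N) (Fin N) ℝ}
    {θ : ℝ → Fin N → ℝ} (h : IsSolution ω K θ) {t : ℝ} (ht : 0 ≤ t) (i : Fin N) :
    HasDerivWithinAt (fun s => θ s i) (field ω K (θ t) i) (Ici 0) t :=
  hasDerivWithinAt_pi.1 (h t ht) i

lemma IsSolution.continuousOn {ω : Fin N → ℝ} {K : Matrix (Fin N) (Fin N) ℝ}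
    {θ : ℝ → Fin N → ℝ} (h : IsSolution ω K θ) (i : Fin N) :
    ContinuousOn (fun s => θ s i) (Ici 0) :=
  fun _ ht => (h.hasDerivWithinAt_apply ht i).continuousWithinAt

/-- A bound on all phase differences propagates as soon as every extremal difference decreases. -/
lemma IsSolution.sub_le_of_drift_neg {ω : Fin N → ℝ} {K : Matrix (Fin N) (Fin N) ℝ}
    {θ : ℝ → Fin N → ℝ} (h : IsSolution ω K θ) {D : ℝ}
    (hdrift : ∀ x : Fin N → ℝ, (∀ i j, x i - x j ≤ D) → ∀ a b, x a - x b = D →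
      field ω K x a - field ω K x b < 0)
    (h0 : ∀ i j, θ 0 i - θ 0 j ≤ D) {T : ℝ} (hT : 0 ≤ T) (i j : Fin N) :
    θ T i - θ T j ≤ D := by
  set S : Set ℝ := {t | ∀ i j, θ t i - θ t j ≤ D} with hS
  have hclosed : IsClosed (S ∩ Icc 0 T) := by
    have : S ∩ Icc 0 T = Icc 0 T ∩ ⋂ i, ⋂ j, (Icc 0 T ∩ {t | θ t i - θ t j ≤ D}) := by
      ext t
      simp only [hS, mem_inter_iff, mem_iInter, mem_ofPred_eq]
      exact ⟨fun h => ⟨h.2, fun i j => ⟨h.2, h.1 i j⟩⟩, fun h => ⟨fun i j => (h.2 i j).2, h.1⟩⟩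
    rw [this]
    refine isClosed_Icc.inter (isClosed_iInter fun i => isClosed_iInter fun j => ?_)
    exact (((h.continuousOn i).sub (h.continuousOn j)).mono
      Icc_subset_Ici_self).preimage_isClosed_of_isClosed isClosed_Icc isClosed_Iic
  -- Continuous induction on [0, T]: a strict bound persists by continuity, and a gap equal to D has
  -- negative right derivative.
  refine hclosed.Icc_subset_of_forall_mem_nhdsWithin h0 ?_ ⟨hT, le_rfl⟩ i j
  rintro t ⟨htS, ht⟩
  change ∀ᶠ s in 𝓝[>] t, ∀ i j, θ s i - θ s j ≤ D
  simp only [eventually_all]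
  intro a b
  have hd : HasDerivWithinAt (fun s => θ s a - θ s b)
      (field ω K (θ t) a - field ω K (θ t) b) (Ioi t) t :=
    ((h.hasDerivWithinAt_apply ht.1 a).sub (h.hasDerivWithinAt_apply ht.1 b)).mono
      (fun s hs => ht.1.trans (le_of_lt hs))
  rcases (htS a b).lt_or_eq with hlt | heq
  · exact (hd.continuousWithinAt.eventually_lt_const hlt).mono fun s hs => hs.le
  · have hneg := hdrift _ htS a b heq
    have hslope := (hasDerivWithinAt_iff_tendsto_slope' (by simp)).1 hd
    filter_upwards [hslope.eventually_lt_const hneg, self_mem_nhdsWithin] with s hs hts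
    rw [slope_def_field, div_lt_iff₀ (sub_pos.2 hts), heq] at hs
    linarith

lemma IsSolution.sub_le_of_phaseSet {ω : Fin N → ℝ} {K : Matrix (Fin N) (Fin N) ℝ} {δ : ℝ}
    (hK : K.IsSymm) (hnonneg : ∀ i j, i < j → 0 ≤ K i j) (hδ : 0 < δ)
    (hgain : GainCondition ω K δ) {θ : ℝ → Fin N → ℝ} (h : IsSolution ω K θ)
    (h0 : (incidence N)ᵀ *ᵥ θ 0 ∈ phaseSet N δ) {T : ℝ} (hT : 0 ≤ T) (i j : Fin N) :
    θ T i - θ T j ≤ Real.pi := by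
  have hK0 : ∀ i j, i ≠ j → 0 ≤ K i j := fun i j hij => by
    rcases lt_or_gt_of_ne hij with h | h
    · exact hnonneg _ _ h
    · rw [← hK.apply]; exact hnonneg _ _ h
  rcases eq_or_ne i j with rfl | hij
  · simpa using Real.pi_pos.le
  have hx : ∀ p : Edge N, -Real.pi + δ < θ 0 p.1.1 - θ 0 p.1.2 ∧
      θ 0 p.1.1 - θ 0 p.1.2 ≤ Real.pi - δ := fun p => by
    rw [← incidence_transpose_mulVec]; exact h0.1 p
  -- An edge exists, and its phase difference lies in the interval (-π + δ, π - δ], which is thus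
  -- nonempty.
  have hδπ : δ < Real.pi := by
    rcases lt_or_gt_of_ne hij with h | h
    · have := hx ⟨(i, j), h⟩; linarith
    · have := hx ⟨(j, i), h⟩; linarith
  suffices θ T i - θ T j ≤ Real.pi - δ by linarith
  refine h.sub_le_of_drift_neg ?_ ?_ hT i j
  · intro x hx a b hab
    have hne : a ≠ b := by rintro rfl; simp at hab; linarith
    have h1 := field_sub_field_le (ω := ω) hK hK0 (by linarith) hx hne hab
    have h2 := sub_lt_pairGain_mul_sin hK hnonneg hgain hδ hδπ hne
    rw [Real.sin_pi_sub] at h1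
    linarith
  · intro a b
    rcases lt_trichotomy a b with h | h | h
    · exact (hx ⟨(a, b), h⟩).2
    · subst h; simp; linarith
    · have := (hx ⟨(b, a), h⟩).1
      simp only at this
      linarith

end Invariance

/-! ### Gradient structure and convergence of the frequencies -/

section Convergence

/-- A version of Barbalat's lemma. -/
lemma tendsto_zero_of_hasDerivWithinAt_neg {U g : ℝ → ℝ} {L m : ℝ}
    (hU : ∀ t, 0 ≤ t → HasDerivWithinAt U (-g t) (Ici 0) t) (hg : ∀ t, 0 ≤ t → 0 ≤ g t)
    (hL : ∀ s t, 0 ≤ s → s ≤ t → |g t - g s| ≤ L * (t - s)) (hm : ∀ t, 0 ≤ t → m ≤ U t) :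
    Tendsto g atTop (𝓝 0) := by
  have hdecr : ∀ s t c, 0 ≤ s → s ≤ t → (∀ r ∈ Icc s t, c ≤ g r) →
      c * (t - s) ≤ U s - U t := by
    intro s t c hs hst hc
    have hmono : AntitoneOn (fun r => U r + c * r) (Icc s t) := by
      refine antitoneOn_of_hasDerivWithinAt_nonpos (f' := fun r => -g r + c * 1)
        (convex_Icc s t) (fun r hr => ?_) (fun r hr => ?_) (fun r hr => ?_)
      · exact (((hU r (hs.trans hr.1)).continuousWithinAt.mono
          (fun x hx => hs.trans hx.1)).add (by fun_prop))
      · rw [interior_Icc] at hr ⊢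
        exact ((hU r (hs.trans hr.1.le)).mono (fun x hx => hs.trans (le_of_lt hx.1))).add
          ((hasDerivWithinAt_id r _).const_mul c)
      · rw [interior_Icc] at hr
        have := hc r ⟨hr.1.le, hr.2.le⟩
        linarith
    have := hmono ⟨le_rfl, hst⟩ ⟨hst, le_rfl⟩ hst
    simp only at this
    linarith
  have hanti : AntitoneOn U (Ici 0) := fun s hs t _ hst => by
    have := hdecr s t 0 hs hst (fun r hr => hg r (le_trans hs hr.1))
    linarith
  set l := sInf (U '' Ici 0)
  have hbdd : BddBelow (U '' Ici 0) := ⟨m, by rintro _ ⟨t, ht, rfl⟩; exact hm t ht⟩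
  have hl : ∀ t, 0 ≤ t → l ≤ U t := fun t ht => csInf_le hbdd ⟨t, ht, rfl⟩
  rw [Metric.tendsto_atTop]
  intro ε hε
  have hL1 : 0 < |L| + 1 := by positivity
  -- If g t ≥ ε, the Lipschitz bound keeps g ≥ ε / 2 on [t, t + η], so U falls by at least εη / 2.
  -- This is impossible once U is within εη / 2 of its infimum. The 1 keeps the denominator
  -- positive.
  set η := ε / (2 * (|L| + 1)) with hη
  have hηpos : 0 < η := by positivity
  have hηL : (|L| + 1) * η = ε / 2 := by rw [hη]; field_simp
  obtain ⟨_, ⟨T, hT, rfl⟩, hTl⟩ := exists_lt_of_csInf_lt (⟨U 0, 0, self_mem_Ici, rfl⟩ :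
    (U '' Ici 0).Nonempty) (show l < l + ε / 2 * η by have : 0 < ε / 2 * η := by positivity
                                                      linarith)
  refine ⟨T, fun t ht => ?_⟩
  have ht0 : 0 ≤ t := le_trans hT ht
  rw [Real.dist_eq, sub_zero, abs_of_nonneg (hg t ht0)]
  by_contra! hge
  have h1 := hdecr t (t + η) (ε / 2) ht0 (by linarith) (fun r hr => by
    have h2 := (abs_le.1 (hL t r ht0 hr.1)).1
    have h3 : L * (r - t) ≤ (|L| + 1) * η :=
      mul_le_mul (by linarith [le_abs_self L]) (by linarith [hr.2]) (by linarith [hr.1]) hL1.le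
    linarith)
  have h4 := hl (t + η) (by linarith)
  have h5 := hanti hT ht0 ht
  have h6 : ε / 2 * (t + η - t) = ε / 2 * η := by ring
  linarith

/-- The potential of the Kuramoto dynamics in the frame rotating with frequency `Ω`. -/
noncomputable def potential (ω : Fin N → ℝ) (K : Matrix (Fin N) (Fin N) ℝ) (Ω : ℝ)
    (θ : Fin N → ℝ) : ℝ :=
  -(1 / 2) * ∑ i, ∑ j, K i j / N * Real.cos (θ j - θ i) - ∑ i, (ω i - Ω) * θ i

/-- The diagonal entries of K are arbitrary, but they multiply sin 0. -/
lemma field_eq_sum (ω : Fin N → ℝ) (K : Matrix (Fin N) (Fin N) ℝ) (θ : Fin N → ℝ) (i : Fin N) :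
    field ω K θ i = ω i + ∑ j, K i j / N * Real.sin (θ j - θ i) := by
  rw [field, ← Finset.add_sum_erase _ _ (Finset.mem_univ i)]; simp

lemma sum_field {K : Matrix (Fin N) (Fin N) ℝ} (hK : K.IsSymm) (ω θ : Fin N → ℝ) :
    ∑ i, field ω K θ i = ∑ i, ω i := by
  simp only [field_eq_sum, Finset.sum_add_distrib]
  have h : ∑ i, ∑ j, K i j / N * Real.sin (θ j - θ i)
      = - ∑ i, ∑ j, K i j / N * Real.sin (θ j - θ i) := by
    conv_lhs => rw [Finset.sum_comm]
    simp only [← Finset.sum_neg_distrib]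
    refine Finset.sum_congr rfl fun i _ => Finset.sum_congr rfl fun j _ => ?_
    rw [hK.apply i j, ← neg_sub, Real.sin_neg]; ring
  linarith

lemma sum_mul_eq_of_antisymm {s : Fin N → Fin N → ℝ} (hs : ∀ i j, s j i = -s i j)
    (v : Fin N → ℝ) : ∑ i, ∑ j, s i j * (v j - v i) = -2 * ∑ i, (∑ j, s i j) * v i := by
  have h1 : ∑ i, ∑ j, s i j * v j = - ∑ i, ∑ j, s i j * v i := by
    rw [Finset.sum_comm]
    simp only [← Finset.sum_neg_distrib]
    refine Finset.sum_congr rfl fun i _ => Finset.sum_congr rfl fun j _ => ?_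
    rw [hs i j]; ring
  simp only [mul_sub, Finset.sum_sub_distrib, h1, Finset.sum_mul]
  ring

lemma IsSolution.hasDerivWithinAt_potential {ω : Fin N → ℝ} {K : Matrix (Fin N) (Fin N) ℝ}
    (hK : K.IsSymm) {θ : ℝ → Fin N → ℝ} (h : IsSolution ω K θ) {Ω : ℝ}
    (hΩ : ∑ i, ω i = N * Ω) {t : ℝ} (ht : 0 ≤ t) :
    HasDerivWithinAt (fun s => potential ω K Ω (θ s))
      (-∑ i, (field ω K (θ t) i - Ω) ^ 2) (Ici 0) t := by
  have hθ := fun i => h.hasDerivWithinAt_apply ht i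
  set F := field ω K (θ t) with hF
  have hd : HasDerivWithinAt (fun s => potential ω K Ω (θ s))
      (-(1 / 2) * ∑ i, ∑ j, K i j / N * (-Real.sin (θ t j - θ t i) * (F j - F i))
        - ∑ i, (ω i - Ω) * F i) (Ici 0) t := by
    unfold potential
    refine ((HasDerivWithinAt.fun_sum fun i _ => HasDerivWithinAt.fun_sum fun j _ =>
      (((hθ j).sub (hθ i)).cos).const_mul _).const_mul _).sub
      (HasDerivWithinAt.fun_sum fun i _ => (hθ i).const_mul _)
  convert hd using 1
  have h1 := sum_mul_eq_of_antisymm (s := fun i j => K i j / N * Real.sin (θ t j - θ t i))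
    (fun i j => by rw [hK.apply i j, ← neg_sub, Real.sin_neg]; ring) F
  have h2 : ∀ i, ∑ j, K i j / N * Real.sin (θ t j - θ t i) = F i - ω i := fun i => by
    rw [hF, field_eq_sum]; ring
  simp only [h2] at h1
  have h3 : ∑ i, ∑ j, K i j / N * (-Real.sin (θ t j - θ t i) * (F j - F i))
      = -∑ i, ∑ j, K i j / N * Real.sin (θ t j - θ t i) * (F j - F i) := by
    simp only [← Finset.sum_neg_distrib]
    refine Finset.sum_congr rfl fun i _ => Finset.sum_congr rfl fun j _ => ?_
    ring
  rw [h3, h1]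
  -- The chain rule gives the rate -∑ (F_i - Ω) F_i; this identity allows F_i to be replaced by F_i
  -- - Ω in the second factor.
  have h4 : ∑ i, (F i - Ω) = 0 := by
    rw [Finset.sum_sub_distrib, hF, sum_field hK, hΩ]; simp
  have h5 : ∑ i, (F i - Ω) ^ 2 = ∑ i, (F i - ω i) * F i + ∑ i, (ω i - Ω) * F i
      - Ω * ∑ i, (F i - Ω) := by
    rw [Finset.mul_sum, ← Finset.sum_add_distrib, ← Finset.sum_sub_distrib]
    exact Finset.sum_congr rfl fun i _ => by ring
  rw [h5, h4]; ring

lemma exists_le_potential (ω : Fin N → ℝ) (K : Matrix (Fin N) (Fin N) ℝ) {Ω : ℝ}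
    (hΩ : ∑ i, ω i = N * Ω) (D : ℝ) :
    ∃ m, ∀ θ : Fin N → ℝ, (∀ i j, θ i - θ j ≤ D) → m ≤ potential ω K Ω θ := by
  rcases isEmpty_or_nonempty (Fin N) with _ | ⟨⟨k⟩⟩
  · exact ⟨0, fun θ _ => by simp [potential]⟩
  refine ⟨-(1 / 2) * ∑ i, ∑ j, |K i j / N| - ∑ i, |ω i - Ω| * D, fun θ hθ => ?_⟩
  -- The coefficients ω_i - Ω sum to zero, so the linear term depends only on phase differences and
  -- a reference phase can be subtracted.
  have h1 : ∑ i, (ω i - Ω) * θ i = ∑ i, (ω i - Ω) * (θ i - θ k) := by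
    have : ∑ i, (ω i - Ω) = 0 := by rw [Finset.sum_sub_distrib, hΩ]; simp
    simp only [mul_sub, Finset.sum_sub_distrib, ← Finset.sum_mul] at this ⊢
    rw [this]; simp
  have h2 : ∑ i, (ω i - Ω) * (θ i - θ k) ≤ ∑ i, |ω i - Ω| * D :=
    Finset.sum_le_sum fun i _ => (le_abs_self _).trans (by
      rw [abs_mul]
      exact mul_le_mul_of_nonneg_left (abs_le.2 ⟨by linarith [hθ k i], hθ i k⟩) (abs_nonneg _))
  have h3 : ∑ i, ∑ j, K i j / N * Real.cos (θ j - θ i) ≤ ∑ i, ∑ j, |K i j / N| :=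
    Finset.sum_le_sum fun i _ => Finset.sum_le_sum fun j _ => (le_abs_self _).trans (by
      rw [abs_mul]; exact mul_le_of_le_one_right (abs_nonneg _) (Real.abs_cos_le_one _))
  unfold potential
  rw [h1]
  linarith

/-- A bound for the absolute value of the right-hand side of the Kuramoto equations. -/
lemma abs_field_le (ω : Fin N → ℝ) (K : Matrix (Fin N) (Fin N) ℝ) (θ : Fin N → ℝ) (i : Fin N) :
    |field ω K θ i| ≤ ∑ i, (|ω i| + ∑ j, |K i j / N|) := by
  refine le_trans ?_ (Finset.single_le_sum (f := fun i => |ω i| + ∑ j, |K i j / N|)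
    (fun i _ => by positivity) (Finset.mem_univ i))
  rw [field_eq_sum]
  refine (abs_add_le _ _).trans ?_
  gcongr
  refine (Finset.abs_sum_le_sum_abs _ _).trans (Finset.sum_le_sum fun j _ => ?_)
  rw [abs_mul]
  exact mul_le_of_le_one_right (abs_nonneg _) (Real.abs_sin_le_one _)

lemma abs_field_sub_field_le (ω : Fin N → ℝ) (K : Matrix (Fin N) (Fin N) ℝ)
    {x y : Fin N → ℝ} {r : ℝ} (hxy : ∀ i, |x i - y i| ≤ r) (i : Fin N) :
    |field ω K x i - field ω K y i| ≤ (∑ j, |K i j / N|) * (2 * r) := by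
  rw [field_eq_sum, field_eq_sum, add_sub_add_left_eq_sub, ← Finset.sum_sub_distrib,
    Finset.sum_mul]
  refine (Finset.abs_sum_le_sum_abs _ _).trans (Finset.sum_le_sum fun j _ => ?_)
  rw [← mul_sub, abs_mul]
  refine mul_le_mul_of_nonneg_left ?_ (abs_nonneg _)
  have h1 : |Real.sin (x j - x i) - Real.sin (y j - y i)| ≤ |(x j - x i) - (y j - y i)| := by
    simpa only [Real.dist_eq, NNReal.coe_one, one_mul] using
      Real.lipschitzWith_sin.dist_le_mul (x j - x i) (y j - y i)
  have h2 : |(x j - x i) - (y j - y i)| ≤ |x j - y j| + |x i - y i| := by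
    rw [show (x j - x i) - (y j - y i) = (x j - y j) - (x i - y i) by ring]
    exact abs_sub _ _
  linarith [hxy i, hxy j]

lemma IsSolution.abs_sub_le {ω : Fin N → ℝ} {K : Matrix (Fin N) (Fin N) ℝ}
    {θ : ℝ → Fin N → ℝ} (h : IsSolution ω K θ) {s t : ℝ} (hs : 0 ≤ s) (hst : s ≤ t)
    (i : Fin N) : |θ t i - θ s i| ≤ (∑ i, (|ω i| + ∑ j, |K i j / N|)) * (t - s) := by
  have := (convex_Ici (0 : ℝ)).norm_image_sub_le_of_norm_hasDerivWithin_le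
    (f := fun s => θ s i) (fun r hr => h.hasDerivWithinAt_apply hr i)
    (fun r _ => abs_field_le ω K (θ r) i) hs (hs.trans hst)
  simpa [Real.norm_eq_abs, abs_of_nonneg (sub_nonneg.2 hst)] using this

/-- Solutions with bounded phase differences synchronize in frequency. -/
lemma IsSolution.frequenciesTendTo {ω : Fin N → ℝ} {K : Matrix (Fin N) (Fin N) ℝ}
    (hK : K.IsSymm) {θ : ℝ → Fin N → ℝ} (h : IsSolution ω K θ) {Ω D : ℝ}
    (hΩ : ∑ i, ω i = N * Ω) (hD : ∀ t, 0 ≤ t → ∀ i j, θ t i - θ t j ≤ D) :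
    FrequenciesTendTo θ Ω := by
  obtain ⟨m, hm⟩ := exists_le_potential ω K hΩ D
  set C := ∑ i, (|ω i| + ∑ j, |K i j / N|) with hC
  have hC0 : 0 ≤ C := by positivity
  have hlim : Tendsto (fun t => ∑ i, (field ω K (θ t) i - Ω) ^ 2) atTop (𝓝 0) := by
    refine tendsto_zero_of_hasDerivWithinAt_neg (m := m)
      -- Each phase is C-Lipschitz in time, which makes field component i Lipschitz with constant (∑
      -- j, |K i j / N|) · 2C; the last factor bounds |y + x - 2Ω| in the difference of squares.
      (L := ∑ i, (∑ j, |K i j / N|) * (2 * C) * (2 * C + 2 * |Ω|))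
      (fun t ht => h.hasDerivWithinAt_potential hK hΩ ht)
      (fun t _ => Finset.sum_nonneg fun i _ => sq_nonneg _) ?_ (fun t ht => hm _ (hD t ht))
    intro s t hs hst
    rw [← Finset.sum_sub_distrib, Finset.sum_mul]
    refine (Finset.abs_sum_le_sum_abs _ _).trans (Finset.sum_le_sum fun i _ => ?_)
    have h1 := abs_field_sub_field_le ω K (fun i => h.abs_sub_le hs hst i) i
    have h2 := abs_field_le ω K (θ s) i
    have h3 := abs_field_le ω K (θ t) i
    rw [← hC] at h1 h2 h3
    set x := field ω K (θ s) i
    set y := field ω K (θ t) i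
    have h4 : |y + x - 2 * Ω| ≤ 2 * C + 2 * |Ω| := by
      have h5 := abs_sub (y + x) (2 * Ω)
      have h6 := abs_add_le y x
      rw [abs_mul, abs_two] at h5
      linarith
    calc |(y - Ω) ^ 2 - (x - Ω) ^ 2| = |y - x| * |y + x - 2 * Ω| := by
          rw [← abs_mul]; congr 1; ring
      _ ≤ ((∑ j, |K i j / N|) * (2 * (C * (t - s)))) * (2 * C + 2 * |Ω|) :=
          mul_le_mul h1 h4 (abs_nonneg _) ((abs_nonneg _).trans h1)
      _ = _ := by ring
  intro i
  have hsq : Tendsto (fun t => (field ω K (θ t) i - Ω) ^ 2) atTop (𝓝 0) :=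
    squeeze_zero (fun t => sq_nonneg _) (fun t => Finset.single_le_sum
      (f := fun i => (field ω K (θ t) i - Ω) ^ 2) (fun i _ => sq_nonneg _)
      (Finset.mem_univ i)) hlim
  have habs : Tendsto (fun t => |field ω K (θ t) i - Ω|) atTop (𝓝 0) := by
    simpa [Real.sqrt_sq_eq_abs] using hsq.sqrt
  have hfield : Tendsto (fun t => field ω K (θ t) i) atTop (𝓝 Ω) := by
    simpa using (tendsto_zero_iff_abs_tendsto_zero _).2 habs |>.add_const Ω
  refine hfield.congr' ?_
  filter_upwards [eventually_gt_atTop 0] with t ht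
  exact (((h.hasDerivWithinAt_apply ht.le i).hasDerivAt (Ici_mem_nhds ht)).deriv).symm

end Convergence

end Kuramoto

theorem mainTheorem7 (N : ℕ) (ω : Fin N → ℝ) (K : Matrix (Fin N) (Fin N) ℝ) (δ : ℝ)
    (hsymm : K.IsSymm) (hnonneg : ∀ i j, i < j → 0 ≤ K i j)
    (hconn : (Kuramoto.couplingGraph K).Connected)
    (hδ : 0 < δ) (hgain : Kuramoto.GainCondition ω K δ) :
    -- initial conditions `(X(0), V(0)) = (Bᵀ θ(0), Bᵀ θ'(0))` in `𝒩`
    (∀ θ : ℝ → Fin N → ℝ, Kuramoto.IsSolution ω K θ →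
      ((Kuramoto.incidence N)ᵀ *ᵥ θ 0,
        (Kuramoto.incidence N)ᵀ *ᵥ Kuramoto.field ω K (θ 0)) ∈ Kuramoto.initialSet ω K δ →
      Kuramoto.FrequenciesTendTo θ ((1 / (N : ℝ)) * ∑ i, ω i)) ∧
    -- the same when only the phase part of `𝒩` is imposed on the initial condition
    (∀ θ : ℝ → Fin N → ℝ, Kuramoto.IsSolution ω K θ →
      (Kuramoto.incidence N)ᵀ *ᵥ θ 0 ∈ Kuramoto.phaseSet N δ →
      Kuramoto.FrequenciesTendTo θ ((1 / (N : ℝ)) * ∑ i, ω i)) := by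
  have hN : (N : ℝ) ≠ 0 := by
    obtain ⟨i⟩ := hconn.nonempty
    exact_mod_cast (Fin.pos i).ne'
  have hΩ : ∑ i, ω i = N * ((1 / (N : ℝ)) * ∑ i, ω i) := by field_simp
  have main : ∀ θ : ℝ → Fin N → ℝ, Kuramoto.IsSolution ω K θ →
      (Kuramoto.incidence N)ᵀ *ᵥ θ 0 ∈ Kuramoto.phaseSet N δ →
      Kuramoto.FrequenciesTendTo θ ((1 / (N : ℝ)) * ∑ i, ω i) := fun θ hθ h0 =>
    hθ.frequenciesTendTo hsymm hΩ fun _ ht i j =>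
      hθ.sub_le_of_phaseSet hsymm hnonneg hδ hgain h0 ht i j
  exact ⟨fun θ hθ h0 => main θ hθ h0.1, main⟩
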